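/- Theorem 1.1. There exists a compact set $E\subset\mathbb{R}^2$ such that $0<\mathcal{H}^1(E)<\infty$, such that $E$ is purely $1$-unrectifiable, and such that for every $1\le p<2$ $$\int_0^1 \beta_{\mathcal{H}^1|_E,p}(x,r)^2\,\frac{dr}{r}<\infty\qquad\text{for }\mathcal{H}^1\text{-a.e. }x\in E .$$ Moreover, the measure $\mu=\mathcal{H}^1|_E$ satisfies $0<\Theta^{1,*}(x,\mu)<\infty$ for $\mu$-a.e. $x$, and $\mu$ is not $1$-rectifiable. Hence, for every $1\le p<2$, the condition $\int_0^1\beta_{\mu,p}(x,r)^2\,\frac{dr}{r}<\infty$ for $\mu$-a.e. $x$ does not imply $1$-rectifiability for Radon measures $\mu$ on $\mathbb{R}^2$ with $0<\Theta^{1,*}(x,\mu)<\infty$ $\mu$-a.e. Here $\mathcal{H}^1$ is the one-dimensional Hausdorff measure and, for a measure $\mu$ on $\mathbb{R}^2$, $x\in\mathbb{R}^2$, $r>0$, $$\beta_{\mu,p}(x,r)=\inf_{L}\left(\int_{B(x,r)}\left(\frac{\operatorname{dist}(y,L)}{r}\right)^p\frac{d\mu(y)}{r}\right)^{1/p},\qquad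 \Theta^{1,*}(x,\mu)=\limsup_{r\to0^+}\frac{\mu(B(x,r))}{2r},$$ where the infimum is over all lines $L\subset\mathbb{R}^2$ and $B(x,r)$ is the closed ball. A measure $\mu$ on $\mathbb{R}^2$ is $1$-rectifiable if $\mu\ll\mathcal{H}^1$ and there are Lipschitz maps $f_i:\mathbb{R}\to\mathbb{R}^2$, $i=1,2,\dots$, with $\mu(\mathbb{R}^2\setminus\bigcup_i f_i(\mathbb{R}))=0$; a set $F$ is $1$-rectifiable if $\mathcal{H}^1|_F$ is; and $E$ is purely $1$-unrectifiable if $\mathcal{H}^1(F)=0$ for every $1$-rectifiable $F\subset E$. -/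

import Mathlib

open MeasureTheory Filter Topology
open scoped ENNReal NNReal

noncomputable section

/-- A measure `μ` on `ℝ^d` is `n`-rectifiable: `μ`-almost all of `ℝ^d` is covered by countably many
Lipschitz images of `ℝ^n`, and `μ` is absolutely continuous with respect to the `n`-dimensional
Hausdorff measure. -/
def MeasureRectifiable {d : ℕ} (n : ℕ) (μ : Measure (EuclideanSpace ℝ (Fin d))) : Prop :=
  (∃ f : ℕ → EuclideanSpace ℝ (Fin n) → EuclideanSpace ℝ (Fin d),
      (∀ i, ∃ K : ℝ≥0, LipschitzWith K (f i)) ∧ μ (⋃ i, Set.range (f i))ᶜ = 0) ∧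
    μ ≪ μH[(n : ℝ)]

/-- A set `E ⊆ ℝ^d` is `n`-rectifiable if the measure `𝓗^n|_E` is. -/
def SetRectifiable {d : ℕ} (n : ℕ) (E : Set (EuclideanSpace ℝ (Fin d))) : Prop :=
  MeasureRectifiable n ((μH[(n : ℝ)] : Measure (EuclideanSpace ℝ (Fin d))).restrict E)

/-- `E` is purely `n`-unrectifiable if all its `n`-rectifiable subsets are `𝓗^n`-null. -/
def PurelyUnrectifiable {d : ℕ} (n : ℕ) (E : Set (EuclideanSpace ℝ (Fin d))) : Prop :=
  ∀ F ⊆ E, SetRectifiable n F → (μH[(n : ℝ)] : Measure (EuclideanSpace ℝ (Fin d))) F = 0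

/-- `L` is an `n`-plane of `ℝ^d`: a nonempty affine subspace of dimension `n`. -/
def IsPlane {d : ℕ} (n : ℕ) (L : AffineSubspace ℝ (EuclideanSpace ℝ (Fin d))) : Prop :=
  (L : Set (EuclideanSpace ℝ (Fin d))).Nonempty ∧ Module.finrank ℝ L.direction = n

/-- The coefficient `β_{μ,p}^n(x,r)` (with values in `[0,∞]`), the infimum over all `n`-planes `L` of
`(∫_{B(x,r)} (dist(y,L)/r)^p dμ(y)/r^n)^{1/p}`. -/
def betaCoeff {d : ℕ} (n : ℕ) (μ : Measure (EuclideanSpace ℝ (Fin d))) (p : ℝ)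
    (x : EuclideanSpace ℝ (Fin d)) (r : ℝ) : ℝ≥0∞ :=
  ⨅ (L : AffineSubspace ℝ (EuclideanSpace ℝ (Fin d))) (_ : IsPlane n L),
    ((∫⁻ y in Metric.closedBall x r,
        ENNReal.ofReal (Metric.infDist y (L : Set (EuclideanSpace ℝ (Fin d))) / r) ^ p ∂μ) /
      ENNReal.ofReal (r ^ n)) ^ (1 / p)

/-- The square function `∫_0^1 β_{μ,p}^n(x,r)^2 dr/r`. For fixed `x`, the coefficient is a
nondecreasing function of `r` times a power of `r`, so the integrand is a measurable function
of `r`. -/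
def betaSquareFunction {d : ℕ} (n : ℕ) (μ : Measure (EuclideanSpace ℝ (Fin d))) (p : ℝ)
    (x : EuclideanSpace ℝ (Fin d)) : ℝ≥0∞ :=
  ∫⁻ r in Set.Ioc (0 : ℝ) 1, betaCoeff n μ p x r ^ 2 / ENNReal.ofReal r

/-- The upper `n`-dimensional density `Θ^{n,*}(x,μ) = limsup_{r → 0+} μ(B(x,r)) / (2r)^n`. -/
def upperDensity {d : ℕ} (n : ℕ) (μ : Measure (EuclideanSpace ℝ (Fin d)))
    (x : EuclideanSpace ℝ (Fin d)) : ℝ≥0∞ :=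
  limsup (fun r : ℝ => μ (Metric.closedBall x r) / ENNReal.ofReal ((2 * r) ^ n)) (𝓝[>] 0)

end

namespace DisplacedGraph

/-! Each interval of generation `j` is cut into `j + 5` children, and the graph over the first child
is lifted by the length of the parent. The set is the closure of the resulting graph over `[0,1]`.

Pieces of the graph over an interval have diameter comparable to its length, so `μH[1]` on the
closure, projected to the first axis, is comparable to Lebesgue measure (`hausdorffMeasure_over_le`,
`volume_le_graphMeasure`). This gives finiteness, positivity and the density bounds.

The lifted fractions `1 / (j + 5)` have divergent sum, so almost every point is lifted infinitely
often. Just right of a lifted child the graph drops by a fixed fraction of the parent's length, so a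
set on which `height` is Lipschitz has gaps near such points, against Lebesgue density
(`volume_eq_zero_of_lipschitz`). Any Lipschitz curve therefore meets the set in a null set.

At radius `r` between half the lengths of generations `m` and `m - 1`, a ball centred on the graph
sees a single value of `base m`. The horizontal line at that height is within `5 / 4 * scale m` of
the graph there, and much closer outside a fraction of order `1 / branching m`. Hence `β ^ 2` is at
most of order `branching m ^ (-2 / p) * (scale m / r) ^ 2` (`betaCoeff_sq_div_le`), and the sum over
`m` converges because `2 / p > 1`. -/

/-- The number of subintervals into which an interval of generation `j` is divided. -/
def branching (j : ℕ) : ℕ := j + 5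

/-- The length of the intervals of generation `j`. -/
noncomputable def scale : ℕ → ℝ
  | 0 => 1
  | j + 1 => scale j / branching j

/-- The index of the interval of generation `j` that contains `t`. -/
noncomputable def index (j : ℕ) (t : ℝ) : ℤ := ⌊t / scale j⌋

/-- `t` lies in the first child of its interval of generation `j`. These children are displaced
vertically by the length of the parent. -/
def Displaced (j : ℕ) (t : ℝ) : Prop := (branching j : ℤ) ∣ index (j + 1) t

open Classical in
/-- The displacement at generation `j`. -/
noncomputable def displacement (j : ℕ) (t : ℝ) : ℝ := if Displaced j t then scale j else 0

/-- The total displacement of the generations before `m`. -/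
noncomputable def base (m : ℕ) (t : ℝ) : ℝ := ∑ j ∈ Finset.range m, displacement j t

/-- The function whose graph is, up to a countable set, the purely unrectifiable set. -/
noncomputable def height (t : ℝ) : ℝ := ∑' j, displacement j t

/-! ### Scales, displacements and tails of the height -/

lemma branching_pos (j : ℕ) : (0 : ℝ) < branching j := by
  simp only [branching]; positivity

lemma five_le_branching (j : ℕ) : (5 : ℝ) ≤ branching j := by
  simp [branching]

lemma scale_pos (j : ℕ) : 0 < scale j := by
  induction j with
  | zero => simp [scale]
  | succ j ih => exact div_pos ih (branching_pos j)

lemma scale_succ (j : ℕ) : scale (j + 1) = scale j / branching j := rfl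

lemma scale_eq_mul (j : ℕ) : scale j = branching j * scale (j + 1) := by
  have := branching_pos j
  rw [scale_succ]; field_simp

lemma scale_succ_le (j : ℕ) : scale (j + 1) ≤ scale j * (1 / 5) := by
  have := five_le_branching j
  have := scale_pos (j + 1)
  rw [scale_eq_mul j]; nlinarith

lemma scale_add_le (m j : ℕ) : scale (m + j) ≤ scale m * (1 / 5) ^ j := by
  induction j with
  | zero => simp
  | succ j ih =>
    have := scale_succ_le (m + j)
    rw [pow_succ, ← add_assoc]; linarith

lemma tendsto_scale : Tendsto scale atTop (𝓝 0) := by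
  refine squeeze_zero (fun j => (scale_pos j).le) (g := fun j => (1 / 5 : ℝ) ^ j) (fun j => ?_)
    (tendsto_pow_atTop_nhds_zero_of_lt_one (by norm_num) (by norm_num))
  simpa [scale] using scale_add_le 0 j

lemma displacement_nonneg (j : ℕ) (t : ℝ) : 0 ≤ displacement j t := by
  unfold displacement; split_ifs
  exacts [(scale_pos j).le, le_rfl]

lemma displacement_le (j : ℕ) (t : ℝ) : displacement j t ≤ scale j := by
  unfold displacement; split_ifs
  exacts [le_rfl, (scale_pos j).le]

lemma displacement_of_displaced {j : ℕ} {t : ℝ} (h : Displaced j t) :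
    displacement j t = scale j := if_pos h

lemma displacement_of_not_displaced {j : ℕ} {t : ℝ} (h : ¬ Displaced j t) :
    displacement j t = 0 := if_neg h

lemma displacement_add_le (m j : ℕ) (t : ℝ) :
    displacement (j + m) t ≤ scale m * (1 / 5) ^ j :=
  (displacement_le _ t).trans (by rw [add_comm j m]; exact scale_add_le m j)

lemma summable_geometric_scale (m : ℕ) : Summable fun j : ℕ => scale m * (1 / 5 : ℝ) ^ j :=
  (summable_geometric_of_lt_one (by norm_num) (by norm_num)).mul_left _

lemma summable_displacement (t : ℝ) : Summable fun j => displacement j t :=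
  Summable.of_nonneg_of_le (fun j => displacement_nonneg j t)
    (fun j => by simpa using displacement_add_le 0 j t) (summable_geometric_scale 0)

lemma height_eq (m : ℕ) (t : ℝ) : height t = base m t + ∑' j, displacement (j + m) t :=
  ((summable_displacement t).sum_add_tsum_nat_add m).symm

lemma base_le_height (m : ℕ) (t : ℝ) : base m t ≤ height t := by
  rw [height_eq m]
  have : 0 ≤ ∑' j, displacement (j + m) t := tsum_nonneg fun j => displacement_nonneg _ t
  linarith

/-- Scales shrink by at least `1 / 5`, and the geometric series of that ratio sums to `5 / 4`. -/
lemma height_le (m : ℕ) (t : ℝ) : height t ≤ base m t + 5 / 4 * scale m := by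
  rw [height_eq m]
  have h : ∑' j, displacement (j + m) t ≤ ∑' j : ℕ, scale m * (1 / 5 : ℝ) ^ j :=
    Summable.tsum_le_tsum (fun j => displacement_add_le m j t)
      ((summable_nat_add_iff m).2 (summable_displacement t)) (summable_geometric_scale m)
  rw [tsum_mul_left, tsum_geometric_of_lt_one (by norm_num) (by norm_num)] at h
  norm_num at h; linarith

lemma base_succ (m : ℕ) (t : ℝ) : base (m + 1) t = base m t + displacement m t :=
  Finset.sum_range_succ _ _

lemma base_zero (t : ℝ) : base 0 t = 0 := Finset.sum_range_zero _

/-! ### Nested intervals and quantised heights -/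

lemma index_eq_div (j : ℕ) (t : ℝ) : index j t = index (j + 1) t / branching j := by
  have h1 := scale_pos (j + 1)
  have h2 := branching_pos j
  rw [index, index, ← Int.floor_div_natCast]
  congr 1
  rw [scale_eq_mul j]; field_simp

lemma index_eq_of_le {m : ℕ} {s t : ℝ} (h : index m s = index m t) {j : ℕ} (hj : j ≤ m) :
    index j s = index j t := by
  induction m, hj using Nat.le_induction with
  | base => exact h
  | succ m _ ih => exact ih (by rw [index_eq_div m s, index_eq_div m t, h])

lemma displaced_congr {j : ℕ} {s t : ℝ} (h : index (j + 1) s = index (j + 1) t) :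
    Displaced j s ↔ Displaced j t := by
  rw [Displaced, Displaced, h]

lemma base_congr {m : ℕ} {s t : ℝ} (h : index m s = index m t) : base m s = base m t := by
  refine Finset.sum_congr rfl fun j hj => ?_
  have := displaced_congr (index_eq_of_le h (Finset.mem_range.1 hj))
  unfold displacement
  split_ifs <;> tauto

lemma abs_sub_lt_scale {m : ℕ} {s t : ℝ} (h : index m s = index m t) : |s - t| < scale m := by
  have h1 := scale_pos m
  have := Int.abs_sub_lt_one_of_floor_eq_floor h
  rwa [← sub_div, abs_div, abs_of_pos h1, div_lt_one h1] at this

lemma abs_height_sub_le_of_base_eq {m : ℕ} {s t : ℝ} (h : base m s = base m t) :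
    |height s - height t| ≤ 5 / 4 * scale m := by
  have h1 := base_le_height m s
  have h2 := base_le_height m t
  have h3 := height_le m s
  have h4 := height_le m t
  rw [abs_le]; constructor <;> linarith

lemma abs_height_sub_le {m : ℕ} {s t : ℝ} (h : index m s = index m t) :
    |height s - height t| ≤ 5 / 4 * scale m :=
  abs_height_sub_le_of_base_eq (base_congr h)

lemma height_nonneg (t : ℝ) : 0 ≤ height t := by simpa [base_zero] using base_le_height 0 t

lemma height_le_const (t : ℝ) : height t ≤ 5 / 4 := by
  simpa [base_zero, scale] using height_le 0 t

/-- Every earlier scale is an integer multiple of `scale m`. This quantisation separates different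
values of `base (m + 1)`. -/
lemma exists_base_eq_mul (m : ℕ) (t : ℝ) : ∃ k : ℤ, base (m + 1) t = k * scale m := by
  induction m with
  | zero =>
    rw [base_succ, base_zero]
    by_cases h : Displaced 0 t
    · exact ⟨1, by rw [displacement_of_displaced h]; simp⟩
    · exact ⟨0, by rw [displacement_of_not_displaced h]; simp⟩
  | succ m ih =>
    obtain ⟨k, hk⟩ := ih
    rw [base_succ, hk, scale_eq_mul m]
    by_cases h : Displaced (m + 1) t
    · exact ⟨k * branching m + 1, by rw [displacement_of_displaced h]; push_cast; ring⟩
    · exact ⟨k * branching m, by rw [displacement_of_not_displaced h]; push_cast; ring⟩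

/-- Points of the graph at vertical distance at most half the length of the intervals of
generation `m` have the same displacement up to that generation. -/
lemma base_eq_of_abs_height_sub_le {m : ℕ} {s t : ℝ} (h : |height s - height t| ≤ scale m / 2) :
    base (m + 1) s = base (m + 1) t := by
  obtain ⟨k, hk⟩ := exists_base_eq_mul m s
  obtain ⟨n, hn⟩ := exists_base_eq_mul m t
  have h0 := scale_pos m
  have h5 := scale_succ_le m
  have h1 := base_le_height (m + 1) s
  have h2 := base_le_height (m + 1) t
  have h3 := height_le (m + 1) s
  have h4 := height_le (m + 1) t
  rw [abs_le] at h
  -- The tails are at most `5 / 4 * scale (m + 1) ≤ scale m / 4`, so the bases differ by at most `3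
  -- / 4 * scale m`.
  have hlt : |((k - n : ℤ) : ℝ)| < 1 := by
    push_cast
    rw [abs_lt]; constructor <;> nlinarith
  have : k - n = 0 := Int.abs_lt_one_iff.1 (by exact_mod_cast hlt)
  rw [hk, hn, sub_eq_zero.1 this]

lemma height_sub_base_le_of_not_displaced {m : ℕ} {t : ℝ} (h : ¬ Displaced m t) :
    height t - base m t ≤ 5 / 4 * scale (m + 1) := by
  have h1 := height_le (m + 1) t
  rw [base_succ, displacement_of_not_displaced h] at h1
  linarith

/-! ### Lebesgue measure of displaced points -/

lemma setOf_index_eq (m : ℕ) (n : ℤ) :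
    {t | index m t = n} = Set.Ico (n * scale m) ((n + 1) * scale m) := by
  ext t
  have := scale_pos m
  simp only [index, Set.mem_ofPred_eq, Int.floor_eq_iff, Set.mem_Ico, le_div_iff₀ this,
    div_lt_iff₀ this]

lemma volume_setOf_index_eq (m : ℕ) (n : ℤ) :
    volume {t | index m t = n} = ENNReal.ofReal (scale m) := by
  rw [setOf_index_eq, Real.volume_Ico]; congr 1; ring

lemma monotone_index (m : ℕ) : Monotone (index m) := fun _ _ h =>
  Int.floor_mono (div_le_div_of_nonneg_right h (scale_pos m).le)

lemma card_index_Icc_le {m : ℕ} {a b : ℝ} (hab : a ≤ b) :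
    ((Finset.Icc (index m a) (index m b)).card : ℝ) * scale m ≤ b - a + 2 * scale m := by
  have h := scale_pos m
  have h1 : index m a ≤ index m b := monotone_index m hab
  have h2 : ((Finset.Icc (index m a) (index m b)).card : ℝ) = index m b + 1 - index m a := by
    rw [Int.card_Icc]
    have : ((index m b + 1 - index m a).toNat : ℤ) = index m b + 1 - index m a :=
      Int.toNat_of_nonneg (by omega)
    exact_mod_cast this
  have h3 : (index m b : ℝ) ≤ b / scale m := Int.floor_le _
  have h4 : a / scale m < index m a + 1 := Int.lt_floor_add_one _
  rw [le_div_iff₀ h] at h3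
  rw [div_lt_iff₀ h] at h4
  rw [h2]; linarith

lemma measurable_index (m : ℕ) : Measurable (index m) :=
  Int.measurable_floor.comp (measurable_id.div_const _)

lemma measurableSet_displaced (j : ℕ) : MeasurableSet {t | Displaced j t} :=
  measurable_index (j + 1) (MeasurableSet.of_discrete (s := {n | (branching j : ℤ) ∣ n}))

/-- The displaced part of an interval that is long for generation `m` has relative measure of
order `1 / branching m`. -/
lemma volume_inter_displaced_le {m : ℕ} {t r : ℝ} (hr : scale m / 2 ≤ r) :
    volume (Set.Icc (t - r) (t + r) ∩ {s | Displaced m s}) ≤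
      ENNReal.ofReal (6 * r / branching m) := by
  have h0 := scale_pos m
  have hq := branching_pos m
  have hsub : Set.Icc (t - r) (t + r) ∩ {s | Displaced m s} ⊆
      ⋃ n ∈ Finset.Icc (index m (t - r)) (index m (t + r)),
        {s | index (m + 1) s = branching m * n} := by
    rintro s ⟨⟨hs1, hs2⟩, hs3⟩
    have hq0 : (branching m : ℤ) ≠ 0 := by simp [branching]; omega
    simp only [Set.mem_iUnion, Finset.mem_Icc, Set.mem_ofPred_eq, exists_prop]
    refine ⟨index m s, ⟨monotone_index m hs1, monotone_index m hs2⟩, ?_⟩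
    rw [index_eq_div m s]
    exact (Int.mul_ediv_cancel' hs3).symm
  calc volume (Set.Icc (t - r) (t + r) ∩ {s | Displaced m s})
      ≤ ∑ n ∈ Finset.Icc (index m (t - r)) (index m (t + r)),
        volume {s | index (m + 1) s = branching m * n} :=
        (measure_mono hsub).trans (measure_biUnion_finset_le _ _)
    _ = ENNReal.ofReal
        ((Finset.Icc (index m (t - r)) (index m (t + r))).card * scale (m + 1)) := by
        rw [Finset.sum_congr rfl fun n _ => volume_setOf_index_eq (m + 1) _, Finset.sum_const,
          nsmul_eq_mul, ENNReal.ofReal_mul (by positivity), ENNReal.ofReal_natCast]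
    _ ≤ ENNReal.ofReal (6 * r / branching m) := by
        apply ENNReal.ofReal_le_ofReal
        -- The number of parents times `scale m` is at most `2 * r + 2 * scale m`, and `scale m ≤ 2
        -- * r`; hence the constant 6.
        have := card_index_Icc_le (m := m) (a := t - r) (b := t + r) (by linarith)
        rw [scale_succ, ← mul_div_assoc]
        refine div_le_div_of_nonneg_right ?_ hq.le
        linarith

/-- A fraction `(j + 4) / (j + 5)` survives each generation `j`, and the product telescopes. -/
lemma volume_never_displaced_le (i k : ℕ) (n : ℤ) :
    volume {t | index i t = n ∧ ∀ j, i ≤ j → j < i + k → ¬ Displaced j t} ≤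
      ENNReal.ofReal (scale i * (i + 4) / (i + k + 4)) := by
  induction k generalizing i n with
  | zero =>
    refine (measure_mono fun t ht => ht.1).trans ((volume_setOf_index_eq i n).le.trans ?_)
    apply ENNReal.ofReal_le_ofReal
    have : (0 : ℝ) < i + 4 := by positivity
    simp only [Nat.cast_zero, add_zero]
    rw [mul_div_cancel_right₀ _ this.ne']
  | succ k ih =>
    have hsub : {t | index i t = n ∧ ∀ j, i ≤ j → j < i + (k + 1) → ¬ Displaced j t} ⊆
        ⋃ d ∈ Finset.Ico 1 (branching i), {t | index (i + 1) t = branching i * n + d ∧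
          ∀ j, i + 1 ≤ j → j < i + 1 + k → ¬ Displaced j t} := by
      rintro t ⟨ht, hd⟩
      have hq0 : 0 < (branching i : ℤ) := by simp only [branching]; positivity
      have h0 := hd i le_rfl (by omega)
      have h1 := Int.emod_nonneg (index (i + 1) t) hq0.ne'
      have h2 := Int.emod_lt_of_pos (index (i + 1) t) hq0
      have h3 := Int.mul_ediv_add_emod (index (i + 1) t) (branching i)
      rw [← index_eq_div, ht] at h3
      rw [Displaced, Int.dvd_iff_emod_eq_zero] at h0
      simp only [Set.mem_iUnion, Finset.mem_Ico, Set.mem_ofPred_eq, exists_prop]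
      exact ⟨(index (i + 1) t % branching i).toNat, by omega, by omega,
        fun j hj1 hj2 => hd j (by omega) (by omega)⟩
    refine (measure_mono hsub).trans ((measure_biUnion_finset_le _ _).trans
      ((Finset.sum_le_sum fun d _ => ih (i + 1) _).trans ?_))
    rw [Finset.sum_const, nsmul_eq_mul, Nat.card_Ico, ← ENNReal.ofReal_natCast,
      ← ENNReal.ofReal_mul (by positivity)]
    apply ENNReal.ofReal_le_ofReal
    have : (branching i - 1 : ℕ) = i + 4 := rfl
    rw [this, scale_succ, branching]
    push_cast
    apply le_of_eq
    have : (i : ℝ) + 5 ≠ 0 := by positivity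
    have : (i : ℝ) + 1 + k + 4 ≠ 0 := by positivity
    have : (i : ℝ) + (k + 1) + 4 ≠ 0 := by positivity
    field_simp
    ring

/-- Almost every point is displaced in infinitely many generations. -/
lemma ae_frequently_displaced : ∀ᵐ t : ℝ, ∃ᶠ j in atTop, Displaced j t := by
  have hnull : ∀ i : ℕ, ∀ n : ℤ, volume {t | index i t = n ∧ ∀ j, i ≤ j → ¬ Displaced j t} = 0 := by
    intro i n
    have hlim : Tendsto (fun k : ℕ => ENNReal.ofReal (scale i * (i + 4) / (i + k + 4))) atTop
        (𝓝 0) := by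
      rw [← ENNReal.ofReal_zero]
      apply ENNReal.tendsto_ofReal
      refine tendsto_const_nhds.div_atTop ?_
      exact tendsto_atTop_add_const_right _ _
        (tendsto_atTop_add_const_left _ _ tendsto_natCast_atTop_atTop)
    refine le_antisymm (ge_of_tendsto' hlim fun k => ?_) zero_le
    refine le_trans (measure_mono ?_) (volume_never_displaced_le i k n)
    exact fun t ht => ⟨ht.1, fun j hj _ => ht.2 j hj⟩
  have : ∀ᵐ t : ℝ, ∀ i : ℕ, ∀ n : ℤ, ¬ (index i t = n ∧ ∀ j, i ≤ j → ¬ Displaced j t) := by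
    rw [ae_all_iff]; intro i; rw [ae_all_iff]; intro n
    rw [ae_iff]; simpa using hnull i n
  filter_upwards [this] with t ht
  rw [frequently_atTop]
  intro i
  by_contra! h
  exact ht i _ ⟨rfl, h⟩

/-! ### Lipschitz functions and curves against the graph -/

/-- A point farther right would lie in an undisplaced child of the same parent, hence at least `3 /
4 * scale j` below the point over `x`, while the Lipschitz bound allows only `scale j / 2`. -/
lemma inter_Icc_subset_of_displaced {A : Set ℝ} {M : ℝ} (hM : 1 ≤ M)
    (hA : ∀ s ∈ A, ∀ t ∈ A, |height s - height t| ≤ M * |s - t|) {x : ℝ} (hx : x ∈ A) {j : ℕ}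
    (hj : Displaced j x) :
    A ∩ Set.Icc x (x + scale j / (2 * M)) ⊆ Set.Icc x (x + scale (j + 1)) := by
  rintro t ⟨htA, ht1, ht2⟩
  have h0 := scale_pos j
  have h1 := scale_pos (j + 1)
  have h5 := scale_succ_le j
  have hq := five_le_branching j
  refine ⟨ht1, ?_⟩
  by_contra! hlt
  have hdist : t - x ≤ scale j / (2 * M) := by linarith
  have hle : scale j / (2 * M) ≤ scale j / 2 :=
    div_le_div_of_nonneg_left h0.le (by norm_num) (by linarith)
  have hidx1 : index (j + 1) x < index (j + 1) t := by
    rw [index, index, Int.lt_iff_add_one_le, Int.le_floor]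
    push_cast
    have : (⌊x / scale (j + 1)⌋ : ℝ) ≤ x / scale (j + 1) := Int.floor_le _
    rw [le_div_iff₀ h1] at this ⊢
    linarith
  have hidx2 : index (j + 1) t < index (j + 1) x + branching j := by
    rw [index, index, Int.floor_lt]
    push_cast
    have : x / scale (j + 1) < ⌊x / scale (j + 1)⌋ + 1 := Int.lt_floor_add_one _
    rw [div_lt_iff₀ h1] at this ⊢
    have h6 := scale_eq_mul j
    nlinarith
  obtain ⟨c, hc⟩ := hj
  have hnd : ¬ Displaced j t := by
    rintro ⟨d, hd⟩
    rw [hc, hd] at hidx1 hidx2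
    have hb : (0 : ℤ) < branching j := by simp only [branching]; positivity
    have h7 : c < d := lt_of_mul_lt_mul_left hidx1 hb.le
    have h8 : (branching j : ℤ) * d < branching j * (c + 1) := by linarith
    have := lt_of_mul_lt_mul_left h8 hb.le
    omega
  have hsame : index j t = index j x := by
    have hb : (0 : ℤ) < branching j := by simp only [branching]; positivity
    rw [index_eq_div j t, index_eq_div j x, hc, Int.mul_ediv_cancel_left _ hb.ne']
    rw [hc] at hidx1 hidx2
    have h7 : index (j + 1) t = index (j + 1) t - branching j * c + branching j * c := by ring
    rw [h7, Int.add_mul_ediv_left _ _ hb.ne', Int.ediv_eq_zero_of_lt (by linarith) (by linarith),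
      zero_add]
  have hxh := base_le_height (j + 1) x
  rw [base_succ, displacement_of_displaced ⟨c, hc⟩, ← base_congr hsame] at hxh
  have hth := height_sub_base_le_of_not_displaced hnd
  have hlip := hA x hx t htA
  have habs : |x - t| ≤ scale j / (2 * M) := by
    rw [abs_sub_comm, abs_of_nonneg (by linarith)]; exact hdist
  have hmul : M * |x - t| ≤ scale j / 2 := by
    calc M * |x - t| ≤ M * (scale j / (2 * M)) := by gcongr
      _ = scale j / 2 := by field_simp
  have := (le_abs_self _).trans (hlip.trans hmul)
  linarith

/-- The function is not Lipschitz on any set of positive measure. -/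
lemma volume_eq_zero_of_lipschitz {A : Set ℝ} {M : ℝ} (hM : 1 ≤ M)
    (hA : ∀ s ∈ A, ∀ t ∈ A, |height s - height t| ≤ M * |s - t|) : volume A = 0 := by
  by_contra hne
  have hden := Besicovitch.ae_tendsto_measure_inter_div (volume : Measure ℝ) A
  have hfre : ∀ᵐ x ∂(volume.restrict A), ∃ᶠ j in atTop, Displaced j x :=
    ae_restrict_of_ae ae_frequently_displaced
  have hnull : volume {x | x ∈ A ∧ ¬ (Tendsto (fun r => volume (A ∩ Metric.closedBall x r) /
      volume (Metric.closedBall x r)) (𝓝[>] 0) (𝓝 1) ∧ ∃ᶠ j in atTop, Displaced j x)} = 0 := by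
    have h := hden.and hfre
    rw [ae_iff] at h
    refine le_antisymm ?_ zero_le
    calc _ ≤ volume.restrict A {x | ¬ (Tendsto (fun r => volume (A ∩ Metric.closedBall x r) /
          volume (Metric.closedBall x r)) (𝓝[>] 0) (𝓝 1) ∧ ∃ᶠ j in atTop, Displaced j x)} := by
          refine le_trans (measure_mono ?_) (Measure.le_restrict_apply _ _)
          exact fun x hx => ⟨hx.2, hx.1⟩
      _ ≤ 0 := h.le
  obtain ⟨x, hxA, hx⟩ : ∃ x ∈ A, Tendsto (fun r => volume (A ∩ Metric.closedBall x r) /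
      volume (Metric.closedBall x r)) (𝓝[>] 0) (𝓝 1) ∧ ∃ᶠ j in atTop, Displaced j x := by
    by_contra! h
    apply hne
    refine measure_mono_null (fun x hx => ?_) hnull
    exact ⟨hx, fun h₁ => h₁.2 (h x hx h₁.1)⟩
  obtain ⟨hlim, hfreq⟩ := hx
  have hr : Tendsto (fun j => scale j / (2 * M)) atTop (𝓝[>] 0) := by
    rw [tendsto_nhdsWithin_iff]
    refine ⟨by simpa using tendsto_scale.div_const (2 * M), .of_forall fun j => ?_⟩
    have := scale_pos j
    exact div_pos this (by linarith)
  have hev := (hlim.comp hr).eventually (lt_mem_nhds (a := ENNReal.ofReal (3 / 4)) (by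
    rw [← ENNReal.ofReal_one]; exact (ENNReal.ofReal_lt_ofReal_iff (by norm_num)).2 (by norm_num)))
  -- For `j ≥ n` the displaced child has length at most `r / 2`, so `A` fills at most `r + r / 2` of
  -- the ball, three quarters of its length.
  obtain ⟨n, hn⟩ := exists_nat_ge (4 * M)
  obtain ⟨j, hjd, hj, hjn⟩ := (hfreq.and_eventually (hev.and (eventually_ge_atTop n))).exists
  have h0 := scale_pos j
  set r := scale j / (2 * M) with hrdef
  have hr0 : 0 < r := div_pos h0 (by linarith)
  have hsub : A ∩ Metric.closedBall x r ⊆ Set.Icc (x - r) x ∪ Set.Icc x (x + scale (j + 1)) := by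
    rintro t ⟨htA, ht⟩
    rw [Real.closedBall_eq_Icc] at ht
    rcases le_total t x with h | h
    · exact Or.inl ⟨ht.1, h⟩
    · exact Or.inr (inter_Icc_subset_of_displaced hM hA hxA hjd ⟨htA, h, ht.2⟩)
  have hscale : scale (j + 1) ≤ r / 2 := by
    have hb : 4 * M ≤ branching j := by
      have : (n : ℝ) ≤ j := by exact_mod_cast hjn
      simp only [branching]; push_cast; linarith
    rw [scale_succ, hrdef, div_div]
    exact div_le_div_of_nonneg_left h0.le (by linarith) (by linarith)
  have hvol : volume (A ∩ Metric.closedBall x r) ≤ ENNReal.ofReal (3 / 4 * (2 * r)) := by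
    refine (measure_mono hsub).trans ((measure_union_le _ _).trans ?_)
    rw [Real.volume_Icc, Real.volume_Icc, ← ENNReal.ofReal_add (by linarith)
      (by have := scale_pos (j + 1); linarith)]
    apply ENNReal.ofReal_le_ofReal
    linarith
  simp only [Function.comp_apply] at hj
  refine absurd hj (not_lt.2 ?_)
  rw [Real.volume_closedBall]
  refine ENNReal.div_le_of_le_mul ?_
  rwa [← ENNReal.ofReal_mul (by norm_num)]

/-- A Lipschitz curve meets the graph over a null set only. -/
lemma volume_setOf_mem_curve_eq_zero {f g : ℝ → ℝ} {K : ℝ≥0} (hf : LipschitzWith K f)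
    (hg : LipschitzWith K g) : volume {t | ∃ s, f s = t ∧ g s = height t} = 0 := by
  set N : Set ℝ := {s | ¬ DifferentiableAt ℝ f s}
  set Z : Set ℝ := {s | DifferentiableAt ℝ f s ∧ deriv f s = 0}
  -- On `S n i`, `f` expands distances below `1 / n` by at least `1 / n`, and fixing the integer
  -- part keeps parameters that close. So `height` is Lipschitz on the image. The exceptional sets
  -- `N` and `Z` have null images by Rademacher and Sard.
  set S : ℕ → ℤ → Set ℝ := fun n i => {s | g s = height (f s) ∧ ⌊s * n⌋ = i ∧
    ∀ s', |s' - s| * n < 1 → |s' - s| ≤ n * |f s' - f s|}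
  have hN : volume (f '' N) = 0 := by
    have h := hf.hausdorffMeasure_image_le (d := 1) zero_le_one N
    rw [hausdorffMeasure_real] at h
    have h2 : volume N = 0 := (hf.ae_differentiableAt (μ := volume))
    rw [h2, mul_zero] at h
    exact le_antisymm h zero_le
  have hZ : volume (f '' Z) = 0 := by
    refine addHaar_image_eq_zero_of_det_fderivWithin_eq_zero volume
      (f' := fun s => fderiv ℝ f s)
      (fun s hs => hs.1.hasFDerivAt.hasFDerivWithinAt) fun s hs => ?_
    have : fderiv ℝ f s = 0 := by
      ext; simpa using hs.2
    rw [this]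
    simp [ContinuousLinearMap.det]
  have hS : ∀ n i, volume (f '' S n i) = 0 := by
    intro n i
    refine volume_eq_zero_of_lipschitz (M := max 1 (K * n)) (le_max_left _ _) ?_
    rintro _ ⟨s, ⟨hs1, hs2, hs3⟩, rfl⟩ _ ⟨t, ⟨ht1, ht2, ht3⟩, rfl⟩
    rw [← hs1, ← ht1]
    have hd : |s - t| * n < 1 := by
      have := Int.abs_sub_lt_one_of_floor_eq_floor (hs2.trans ht2.symm)
      rwa [← sub_mul, abs_mul, Nat.abs_cast] at this
    calc |g s - g t| ≤ K * |s - t| := by simpa [Real.dist_eq] using hg.dist_le_mul s t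
      _ ≤ K * (n * |f s - f t|) := by gcongr; exact ht3 s hd
      _ = K * n * |f s - f t| := by ring
      _ ≤ _ := by gcongr; exact le_max_right _ _
  refine measure_mono_null (t := f '' N ∪ f '' Z ∪ ⋃ n, ⋃ i, f '' S n i) ?_
    (measure_union_null (measure_union_null hN hZ)
      (measure_iUnion_null fun n => measure_iUnion_null (hS n)))
  rintro t ⟨s, rfl, hs⟩
  by_cases hd : DifferentiableAt ℝ f s
  swap
  · exact Or.inl (Or.inl ⟨s, hd, rfl⟩)
  by_cases h0 : deriv f s = 0
  · exact Or.inl (Or.inr ⟨s, ⟨hd, h0⟩, rfl⟩)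
  refine Or.inr ?_
  obtain ⟨δ, hδ, hδ'⟩ : ∃ δ > 0, ∀ s', |s' - s| < δ →
      |deriv f s| / 2 * |s' - s| ≤ |f s' - f s| := by
    have h := hd.hasDerivAt.isLittleO.def (c := |deriv f s| / 2) (by positivity)
    obtain ⟨δ, hδ, h⟩ := Metric.eventually_nhds_iff.1 h
    refine ⟨δ, hδ, fun s' hs' => ?_⟩
    have h1 := h (y := s') (by rwa [Real.dist_eq])
    simp only [smul_eq_mul, Real.norm_eq_abs] at h1
    have h2 := abs_sub_abs_le_abs_sub ((s' - s) * deriv f s) (f s' - f s)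
    rw [abs_mul, abs_sub_comm ((s' - s) * deriv f s)] at h2
    linarith
  obtain ⟨n, hn⟩ := exists_nat_ge (max (1 / δ) (2 / |deriv f s|))
  have hc : 0 < |deriv f s| := abs_pos.2 h0
  have hn1 : 1 ≤ n * δ := (div_le_iff₀ hδ).1 ((le_max_left _ _).trans hn)
  have hn2 : 2 ≤ n * |deriv f s| := (div_le_iff₀ hc).1 ((le_max_right _ _).trans hn)
  refine Set.mem_iUnion.2 ⟨n, Set.mem_iUnion.2 ⟨⌊s * n⌋, s, ⟨hs, rfl, fun s' hs' => ?_⟩, rfl⟩⟩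
  have hlt : |s' - s| < δ := by
    have hn0 : (0 : ℝ) < n := by
      by_contra! h
      nlinarith
    nlinarith
  have := hδ' s' hlt
  calc |s' - s| ≤ n * (|deriv f s| / 2 * |s' - s|) := by nlinarith [abs_nonneg (s' - s)]
    _ ≤ _ := by gcongr

/-! ### Hausdorff measure over subsets of the axis -/

/-- The point of the graph over `t`. -/
noncomputable def point (t : ℝ) : EuclideanSpace ℝ (Fin 2) := !₂[t, height t]

@[simp] lemma point_zero (t : ℝ) : point t 0 = t := by simp [point]

@[simp] lemma point_one (t : ℝ) : point t 1 = height t := by simp [point]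

lemma dist_le_abs_add_abs (x y : EuclideanSpace ℝ (Fin 2)) :
    dist x y ≤ |x 0 - y 0| + |x 1 - y 1| := by
  rw [EuclideanSpace.dist_eq, Fin.sum_univ_two, Real.dist_eq, Real.dist_eq]
  apply Real.sqrt_le_iff.2
  constructor
  · positivity
  · nlinarith [abs_nonneg (x 0 - y 0), abs_nonneg (x 1 - y 1)]

lemma abs_coord_sub_le_dist (x y : EuclideanSpace ℝ (Fin 2)) (i : Fin 2) :
    |x i - y i| ≤ dist x y := by
  rw [dist_eq_norm, ← Real.norm_eq_abs]
  exact PiLp.norm_apply_le (x - y) i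

lemma dist_point_le {m : ℕ} {s t : ℝ} (h : index m s = index m t) :
    dist (point s) (point t) ≤ 3 * scale m := by
  have h0 := dist_le_abs_add_abs (point s) (point t)
  have h1 := abs_sub_lt_scale h
  have h2 := abs_height_sub_le h
  have h3 := scale_pos m
  simp only [point_zero, point_one] at h0
  linarith

lemma ediam_piece_le (m : ℕ) (n : ℤ) :
    Metric.ediam (closure (point '' {t | index m t = n})) ≤ ENNReal.ofReal (3 * scale m) := by
  rw [Metric.ediam_closure]
  refine Metric.ediam_le ?_
  rintro _ ⟨s, hs, rfl⟩ _ ⟨t, ht, rfl⟩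
  rw [edist_dist]
  exact ENNReal.ofReal_le_ofReal (dist_point_le (hs.trans ht.symm))

/-- The margin `scale m` admits approximating points whose abscissa falls just outside `[a, b]`;
finiteness of the union lets the closure pass through it. -/
lemma closure_range_inter_subset {m : ℕ} {a b : ℝ} :
    closure (Set.range point) ∩ {z | z 0 ∈ Set.Icc a b} ⊆
      ⋃ n ∈ Finset.Icc (index m (a - scale m)) (index m (b + scale m)),
        closure (point '' {t | index m t = n}) := by
  rintro z ⟨hz, hz0⟩
  have h0 := scale_pos m
  rw [← Finset.closure_biUnion]
  rw [Metric.mem_closure_iff] at hz ⊢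
  intro ε hε
  obtain ⟨_, ⟨t, rfl⟩, ht⟩ := hz (min ε (scale m)) (lt_min hε h0)
  have h1 := abs_lt.1 ((abs_coord_sub_le_dist z (point t) 0).trans_lt
    (ht.trans_le (min_le_right _ _)))
  rw [point_zero] at h1
  refine ⟨point t, ?_, ht.trans_le (min_le_left _ _)⟩
  simp only [Set.mem_iUnion, exists_prop]
  refine ⟨index m t, ?_, t, rfl, rfl⟩
  rw [Finset.mem_Icc]
  exact ⟨monotone_index m (by linarith [hz0.1]), monotone_index m (by linarith [hz0.2])⟩

lemma hausdorffMeasure_over_Icc_le {a b : ℝ} (hab : a ≤ b) :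
    (μH[1] : Measure (EuclideanSpace ℝ (Fin 2)))
      (closure (Set.range point) ∩ {z | z 0 ∈ Set.Icc a b}) ≤ ENNReal.ofReal (3 * (b - a)) := by
  have hlim : ∀ c d : ℝ, Tendsto (fun m => ENNReal.ofReal (c + d * scale m)) atTop
      (𝓝 (ENNReal.ofReal c)) := fun c d => by
    refine ENNReal.tendsto_ofReal ?_
    simpa using (tendsto_scale.const_mul d).const_add c
  refine (Measure.hausdorffMeasure_le_liminf_sum
    (ι := fun m => Finset.Icc (index m (a - scale m)) (index m (b + scale m))) 1 _ (l := atTop)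
    (fun m => ENNReal.ofReal (0 + 3 * scale m)) (by simpa using hlim 0 3)
    (fun m n => closure (point '' {t | index m t = n}))
    (.of_forall fun m n => by simpa using ediam_piece_le m n)
    (.of_forall fun m => ?_)).trans ?_
  · intro z hz
    have h := closure_range_inter_subset (m := m) hz
    simp only [Set.mem_iUnion] at h ⊢
    obtain ⟨n, hn, hz⟩ := h
    exact ⟨⟨n, hn⟩, hz⟩
  · rw [← (hlim (3 * (b - a)) 12).liminf_eq]
    refine liminf_le_liminf (.of_forall fun m => ?_)
    have h0 := scale_pos m
    have hcard := card_index_Icc_le (m := m) (a := a - scale m) (b := b + scale m) (by linarith)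
    calc ∑ n : Finset.Icc (index m (a - scale m)) (index m (b + scale m)),
          Metric.ediam (closure (point '' {t | index m t = n})) ^ (1 : ℝ)
        ≤ ∑ n : Finset.Icc (index m (a - scale m)) (index m (b + scale m)),
          ENNReal.ofReal (3 * scale m) :=
          Finset.sum_le_sum fun n _ => by rw [ENNReal.rpow_one]; exact ediam_piece_le m n
      _ = ENNReal.ofReal
          ((Finset.Icc (index m (a - scale m)) (index m (b + scale m))).card * (3 * scale m)) := by
          rw [Finset.sum_const, nsmul_eq_mul, ENNReal.ofReal_mul (Nat.cast_nonneg _),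
            ENNReal.ofReal_natCast, Finset.card_univ, Fintype.card_coe]
      _ ≤ _ := ENNReal.ofReal_le_ofReal (by linarith)

/-- The projection of the one-dimensional Hausdorff measure on the closure of the graph is
bounded by a multiple of Lebesgue measure. -/
lemma hausdorffMeasure_over_le (A : Set ℝ) :
    (μH[1] : Measure (EuclideanSpace ℝ (Fin 2)))
      (closure (Set.range point) ∩ {z | z 0 ∈ A}) ≤ 3 * volume A := by
  set τ : OuterMeasure ℝ := OuterMeasure.map (fun z : EuclideanSpace ℝ (Fin 2) => z 0)
    (OuterMeasure.restrict (closure (Set.range point))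
      (μH[1] : Measure (EuclideanSpace ℝ (Fin 2))).toOuterMeasure)
  have hτ : ∀ A, τ A = (μH[1] : Measure (EuclideanSpace ℝ (Fin 2)))
      (closure (Set.range point) ∩ {z | z 0 ∈ A}) := fun A => by
    simp only [τ, OuterMeasure.map_apply, OuterMeasure.restrict_apply, Set.inter_comm]
    rfl
  -- Lebesgue outer measure is the largest outer measure dominated by length. Working with outer
  -- measures avoids any measurability assumption on `A`.
  have h : (3⁻¹ : ℝ≥0∞) • τ ≤ StieltjesFunction.id.outer := by
    rw [StieltjesFunction.outer, OuterMeasure.le_ofFunction]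
    intro s
    rw [StieltjesFunction.length_eq]
    refine le_iInf₂ fun a b => le_iInf fun hs => ?_
    -- `botSet` is empty in `ℝ`, which has no least element.
    have hs' : s ⊆ Set.Ioc a b := fun x hx =>
      hs ⟨hx, notMem_botSet_of_lt (sub_one_lt x)⟩
    rcases lt_or_ge b a with hab | hab
    · rw [Set.Ioc_eq_empty (by linarith)] at hs'
      rw [Set.subset_empty_iff.1 hs']; simp
    · have h1 : τ s ≤ 3 * ENNReal.ofReal (b - a) := by
        calc τ s ≤ τ (Set.Icc a b) := measure_mono (hs'.trans Set.Ioc_subset_Icc_self)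
          _ ≤ ENNReal.ofReal (3 * (b - a)) := by
            rw [hτ]; exact hausdorffMeasure_over_Icc_le hab
          _ = _ := by rw [ENNReal.ofReal_mul (by norm_num)]; norm_num
      calc ((3⁻¹ : ℝ≥0∞) • τ) s = 3⁻¹ * τ s := rfl
        _ ≤ 3⁻¹ * (3 * ENNReal.ofReal (b - a)) := by gcongr
        _ = ENNReal.ofReal (b - a) := by
          rw [← mul_assoc, ENNReal.inv_mul_cancel (by norm_num) (by norm_num), one_mul]
  have hvol : volume A = StieltjesFunction.id.outer A := by
    rw [Real.volume_eq_stieltjes_id, StieltjesFunction.measure]; rfl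
  rw [hvol, ← hτ]
  calc τ A = 3 * (3⁻¹ * τ A) := by
        rw [← mul_assoc, ENNReal.mul_inv_cancel (by norm_num) (by norm_num), one_mul]
    _ ≤ _ := by gcongr; exact h A

/-! ### The compact set and its measure -/

/-- The endpoints of the intervals of all generations. -/
def endpoints : Set ℝ := ⋃ m : ℕ, Set.range fun n : ℤ => n * scale m

lemma volume_endpoints : volume endpoints = 0 :=
  (Set.countable_iUnion fun _ => Set.countable_range _).measure_zero _

/-- Off the endpoints, `t` is interior to its interval of every generation, and the pieces of the
graph shrink. -/
lemma continuousAt_point {t : ℝ} (ht : t ∉ endpoints) : ContinuousAt point t := by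
  rw [Metric.continuousAt_iff']
  intro ε hε
  obtain ⟨m, hm⟩ := ((tendsto_scale.const_mul 3).eventually
    (gt_mem_nhds (show 3 * (0 : ℝ) < ε by simpa))).exists
  have h0 := scale_pos m
  have hmem : {s | index m s = index m t} ∈ 𝓝 t := by
    rw [setOf_index_eq]
    have h1 : t ∈ {s | index m s = index m t} := rfl
    rw [setOf_index_eq] at h1
    refine Ico_mem_nhds (lt_of_le_of_ne h1.1 fun h => ht ?_) h1.2
    exact Set.mem_iUnion.2 ⟨m, index m t, h⟩
  filter_upwards [hmem] with s hs
  exact (dist_point_le hs).trans_lt hm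

/-- Away from the endpoints the closure of the graph is the graph. -/
lemma eq_point_of_mem_closure {z : EuclideanSpace ℝ (Fin 2)} (hz : z ∈ closure (Set.range point))
    (h0 : z 0 ∉ endpoints) : z = point (z 0) := by
  obtain ⟨x, hx, hlim⟩ := mem_closure_iff_seq_limit.1 hz
  choose u hu using hx
  have h1 : Tendsto u atTop (𝓝 (z 0)) := by
    have : Tendsto (fun n => x n 0) atTop (𝓝 (z 0)) :=
      ((EuclideanSpace.proj (𝕜 := ℝ) (0 : Fin 2)).continuous.tendsto z).comp hlim
    refine this.congr fun n => ?_
    rw [← hu n, point_zero]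
  have h2 := (continuousAt_point h0).tendsto.comp h1
  exact tendsto_nhds_unique hlim (h2.congr hu)

/-- The closure of the graph over the unit interval. -/
def graphClosure : Set (EuclideanSpace ℝ (Fin 2)) := closure (point '' Set.Icc 0 1)

lemma graphClosure_subset : graphClosure ⊆ closure (Set.range point) :=
  closure_mono (Set.image_subset_range _ _)

lemma measurableSet_graphClosure : MeasurableSet graphClosure := isClosed_closure.measurableSet

lemma isCompact_graphClosure : IsCompact graphClosure := by
  refine Metric.isCompact_of_isClosed_isBounded isClosed_closure (Bornology.IsBounded.closure ?_)
  refine (Metric.isBounded_closedBall (x := (0 : EuclideanSpace ℝ (Fin 2))) (r := 3)).subset ?_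
  rintro _ ⟨t, ht, rfl⟩
  rw [Metric.mem_closedBall]
  refine (dist_le_abs_add_abs _ _).trans ?_
  have h1 := height_nonneg t
  have h2 := height_le_const t
  simp only [point_zero, point_one, PiLp.zero_apply, sub_zero]
  rw [abs_of_nonneg h1, abs_of_nonneg ht.1]
  linarith [ht.2]

lemma coord_zero_mem {z : EuclideanSpace ℝ (Fin 2)} (hz : z ∈ graphClosure) :
    z 0 ∈ Set.Icc (0 : ℝ) 1 := by
  have hcont : Continuous fun z : EuclideanSpace ℝ (Fin 2) => z 0 :=
    (EuclideanSpace.proj (𝕜 := ℝ) (0 : Fin 2)).continuous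
  refine closure_minimal ?_ (isClosed_Icc.preimage hcont) hz
  rintro _ ⟨t, ht, rfl⟩
  simpa using ht

/-- The one-dimensional Hausdorff measure on the closure of the graph. -/
noncomputable def graphMeasure : Measure (EuclideanSpace ℝ (Fin 2)) :=
  (μH[1] : Measure (EuclideanSpace ℝ (Fin 2))).restrict graphClosure

lemma graphMeasure_over_le (A : Set ℝ) : graphMeasure {z | z 0 ∈ A} ≤ 3 * volume A := by
  refine le_trans ?_ (hausdorffMeasure_over_le A)
  rw [graphMeasure, Measure.restrict_apply' measurableSet_graphClosure, Set.inter_comm]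
  exact measure_mono (Set.inter_subset_inter_left _ graphClosure_subset)

lemma volume_le_hausdorffMeasure (S : Set (EuclideanSpace ℝ (Fin 2))) :
    volume ((fun z => z 0) '' S) ≤ (μH[1] : Measure (EuclideanSpace ℝ (Fin 2))) S := by
  have h : LipschitzWith 1 fun z : EuclideanSpace ℝ (Fin 2) => z 0 :=
    LipschitzWith.of_dist_le_mul fun x y => by
      simpa [Real.dist_eq] using abs_coord_sub_le_dist x y 0
  simpa [hausdorffMeasure_real] using h.hausdorffMeasure_image_le zero_le_one S

lemma volume_le_graphMeasure {A : Set ℝ} (hA : A ⊆ Set.Icc 0 1)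
    {S : Set (EuclideanSpace ℝ (Fin 2))} (hS : ∀ t ∈ A, point t ∈ S) :
    volume A ≤ graphMeasure S := by
  rw [graphMeasure, Measure.restrict_apply' measurableSet_graphClosure]
  refine le_trans (measure_mono fun t ht => ?_) (volume_le_hausdorffMeasure _)
  exact ⟨point t, ⟨hS t ht, subset_closure ⟨t, hA ht, rfl⟩⟩, point_zero t⟩

lemma ae_graphMeasure : ∀ᵐ z ∂graphMeasure, z 0 ∈ Set.Ico (0 : ℝ) 1 ∧ z = point (z 0) := by
  have h1 : ∀ᵐ z ∂graphMeasure, z ∈ graphClosure := ae_restrict_mem measurableSet_graphClosure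
  have h2 : ∀ᵐ z ∂graphMeasure, z 0 ∉ endpoints := by
    rw [ae_iff]
    simpa [volume_endpoints] using graphMeasure_over_le endpoints
  filter_upwards [h1, h2] with z hz hz0
  refine ⟨⟨(coord_zero_mem hz).1, lt_of_le_of_ne (coord_zero_mem hz).2 fun h => hz0 ?_⟩,
    eq_point_of_mem_closure (graphClosure_subset hz) hz0⟩
  exact Set.mem_iUnion.2 ⟨0, 1, by simp [scale, h]⟩

/-! ### Density and total mass -/

lemma graphMeasure_closedBall_le (x : EuclideanSpace ℝ (Fin 2)) (r : ℝ) :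
    graphMeasure (Metric.closedBall x r) ≤ 3 * ENNReal.ofReal (2 * r) := by
  have hsub : Metric.closedBall x r ⊆ {z | z 0 ∈ Metric.closedBall (x 0) r} := fun z hz => by
    refine Metric.mem_closedBall.2 ?_
    rw [Real.dist_eq]
    exact (abs_coord_sub_le_dist z x 0).trans hz
  refine (measure_mono hsub).trans ((graphMeasure_over_le _).trans ?_)
  rw [Real.volume_closedBall]

lemma mem_Icc_of_index_eq {m : ℕ} {s t : ℝ} (ht : t ∈ Set.Ico (0 : ℝ) 1)
    (h : index m s = index m t) : s ∈ Set.Icc (0 : ℝ) 1 := by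
  have h0 : index 0 s = 0 := by
    rw [index_eq_of_le h (Nat.zero_le m), index, Int.floor_eq_zero_iff]
    simpa [scale] using ht
  have h1 : s ∈ {s | index 0 s = 0} := h0
  rw [setOf_index_eq] at h1
  simp only [scale, Int.cast_zero, mul_one, zero_add] at h1
  exact Set.Ico_subset_Icc_self h1

lemma scale_le_graphMeasure_closedBall {t : ℝ} (ht : t ∈ Set.Ico (0 : ℝ) 1) (m : ℕ) :
    ENNReal.ofReal (scale m) ≤ graphMeasure (Metric.closedBall (point t) (3 * scale m)) := by
  rw [← volume_setOf_index_eq m (index m t)]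
  refine volume_le_graphMeasure (fun s hs => mem_Icc_of_index_eq ht hs) fun s hs => ?_
  exact dist_point_le hs

lemma upperDensity_graphMeasure_lt_top (x : EuclideanSpace ℝ (Fin 2)) :
    upperDensity 1 graphMeasure x < ∞ := by
  refine lt_of_le_of_lt ?_ (ENNReal.ofNat_lt_top (n := 3))
  refine limsup_le_of_le (by isBoundedDefault) (.of_forall fun r => ?_)
  rw [pow_one]
  exact ENNReal.div_le_of_le_mul (graphMeasure_closedBall_le x r)

lemma upperDensity_graphMeasure_pos {t : ℝ} (ht : t ∈ Set.Ico (0 : ℝ) 1) :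
    0 < upperDensity 1 graphMeasure (point t) := by
  refine lt_of_lt_of_le (b := ENNReal.ofReal (1 / 6)) (by simp) ?_
  have hlim : Tendsto (fun m => 3 * scale m) atTop (𝓝[>] 0) := by
    rw [tendsto_nhdsWithin_iff]
    exact ⟨by simpa using tendsto_scale.const_mul 3,
      .of_forall fun m => mul_pos (by norm_num) (scale_pos m)⟩
  refine le_limsup_of_frequently_le (hlim.frequently (Eventually.frequently
    (.of_forall fun m => ?_))) (by isBoundedDefault)
  have h0 := scale_pos m
  rw [ENNReal.le_div_iff_mul_le (Or.inl (by simpa using h0)) (Or.inl ENNReal.ofReal_ne_top),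
    ← ENNReal.ofReal_mul (by norm_num)]
  refine le_trans (le_of_eq ?_) (scale_le_graphMeasure_closedBall ht m)
  congr 1; ring

lemma hausdorffMeasure_graphClosure_pos :
    0 < (μH[1] : Measure (EuclideanSpace ℝ (Fin 2))) graphClosure := by
  have h := volume_le_graphMeasure (A := Set.Icc 0 1) subset_rfl (S := Set.univ)
    fun _ _ => Set.mem_univ _
  rw [graphMeasure, Measure.restrict_apply_univ, Real.volume_Icc] at h
  exact lt_of_lt_of_le (by simp) h

lemma hausdorffMeasure_graphClosure_lt_top :
    (μH[1] : Measure (EuclideanSpace ℝ (Fin 2))) graphClosure < ∞ := by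
  have h := hausdorffMeasure_over_le (Set.Icc 0 1)
  refine lt_of_le_of_lt ((measure_mono fun z hz => ?_).trans h) ?_
  · exact ⟨graphClosure_subset hz, coord_zero_mem hz⟩
  · rw [Real.volume_Icc]
    exact ENNReal.mul_lt_top (by norm_num) ENNReal.ofReal_lt_top

/-! ### Pure unrectifiability -/

lemma graphMeasure_range_eq_zero {f : ℝ → EuclideanSpace ℝ (Fin 2)} {K : ℝ≥0}
    (hf : LipschitzWith K f) : graphMeasure (Set.range f) = 0 := by
  have hcoord : ∀ i, LipschitzWith K fun s => f s i := fun i =>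
    LipschitzWith.of_dist_le_mul fun x y => by
      rw [Real.dist_eq]
      exact (abs_coord_sub_le_dist _ _ i).trans (hf.dist_le_mul x y)
  have h := graphMeasure_over_le {t | ∃ s, f s 0 = t ∧ f s 1 = height t}
  rw [volume_setOf_mem_curve_eq_zero (hcoord 0) (hcoord 1), mul_zero] at h
  refine le_antisymm ((measure_mono_ae ?_).trans h) zero_le
  filter_upwards [ae_graphMeasure] with z hz
  rintro ⟨s, rfl⟩
  refine ⟨s, rfl, ?_⟩
  have := congrArg (fun z : EuclideanSpace ℝ (Fin 2) => z 1) hz.2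
  simpa using this

lemma graphMeasure_range_fin_one_eq_zero {f : EuclideanSpace ℝ (Fin 1) → EuclideanSpace ℝ (Fin 2)}
    {K : ℝ≥0} (hf : LipschitzWith K f) : graphMeasure (Set.range f) = 0 := by
  have hline : Isometry fun s : ℝ => EuclideanSpace.single (0 : Fin 1) s :=
    Isometry.of_dist_eq fun s t => PiLp.dist_single_same 2 (fun _ => ℝ) 0 s t
  have hsurj : Function.Surjective fun s : ℝ => EuclideanSpace.single (0 : Fin 1) s := by
    intro v
    use v 0
    apply PiLp.ext
    intro j
    have hj : j = 0 := Subsingleton.elim j 0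
    subst hj
    simp
  rw [← hsurj.range_comp f]
  exact graphMeasure_range_eq_zero (hf.comp hline.lipschitz)

lemma purelyUnrectifiable_graphClosure : PurelyUnrectifiable 1 graphClosure := by
  intro F hF hrect
  obtain ⟨⟨f, hf, hnull⟩, -⟩ := hrect
  rw [Nat.cast_one] at hnull ⊢
  have hF1 : (μH[1] : Measure (EuclideanSpace ℝ (Fin 2))) (F ∩ ⋃ i, Set.range (f i)) = 0 := by
    refine measure_mono_null ?_ (le_antisymm
      ((Measure.le_restrict_apply graphClosure (⋃ i, Set.range (f i))).trans
        (measure_iUnion_null fun i =>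
          graphMeasure_range_fin_one_eq_zero (hf i).choose_spec).le) zero_le)
    exact fun z hz => ⟨hz.2, hF hz.1⟩
  have hF2 := le_antisymm ((Measure.le_restrict_apply F _).trans hnull.le) zero_le
  refine measure_mono_null (fun z hz => ?_) (measure_union_null hF1 hF2)
  by_cases h : z ∈ ⋃ i, Set.range (f i)
  · exact Or.inl ⟨hz, h⟩
  · exact Or.inr ⟨h, hz⟩

/-! ### Beta coefficients and the square function -/

/-- The horizontal line at height `b`. -/
noncomputable def horizontalLine (b : ℝ) : AffineSubspace ℝ (EuclideanSpace ℝ (Fin 2)) :=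
  AffineSubspace.mk' !₂[0, b] (Submodule.span ℝ {EuclideanSpace.single 0 1})

lemma isPlane_horizontalLine (b : ℝ) : IsPlane 1 (horizontalLine b) := by
  refine ⟨AffineSubspace.mk'_nonempty _ _, ?_⟩
  rw [horizontalLine, AffineSubspace.direction_mk']
  exact finrank_span_singleton (by simp)

lemma infDist_horizontalLine_le (y : EuclideanSpace ℝ (Fin 2)) (b : ℝ) :
    Metric.infDist y (horizontalLine b : Set (EuclideanSpace ℝ (Fin 2))) ≤ |y 1 - b| := by
  have hmem : !₂[y 0, b] ∈ horizontalLine b := by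
    rw [horizontalLine, AffineSubspace.mem_mk', Submodule.mem_span_singleton]
    refine ⟨y 0, ?_⟩
    ext i
    fin_cases i <;> simp
  refine (Metric.infDist_le_dist_of_mem hmem).trans ((dist_le_abs_add_abs _ _).trans ?_)
  simp

lemma infDist_point_horizontalLine_le (m : ℕ) (t : ℝ) :
    Metric.infDist (point t) (horizontalLine (base m t) : Set (EuclideanSpace ℝ (Fin 2))) ≤
      height t - base m t := by
  refine (infDist_horizontalLine_le _ _).trans ?_
  rw [point_one, abs_of_nonneg (sub_nonneg.2 (base_le_height m t))]

/-- With `a = 5 / 4 * scale m / r`, displaced points contribute `a ^ p` on mass at most `18 * r /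
branching m`, the others at most `a ^ p / branching m` on mass at most `6 * r`. -/
lemma lintegral_infDist_rpow_le {m : ℕ} {t r p : ℝ} (hp : 1 ≤ p) (hr : scale m / 2 ≤ r)
    (hbase : ∀ s, |height s - height t| ≤ r → base m s = base m t) :
    ∫⁻ y in Metric.closedBall (point t) r, ENNReal.ofReal (Metric.infDist y
      (horizontalLine (base m t) : Set (EuclideanSpace ℝ (Fin 2))) / r) ^ p ∂graphMeasure ≤
      ENNReal.ofReal (24 * r * (5 / 4 * scale m / r) ^ p / branching m) := by
  have h0 := scale_pos m
  have hq := branching_pos m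
  have hr0 : 0 < r := by linarith
  set a := 5 / 4 * scale m / r with ha
  have ha0 : 0 < a := by positivity
  set B := Metric.closedBall (point t) r
  set Z : Set (EuclideanSpace ℝ (Fin 2)) := {z | z 0 ∈ {s | Displaced m s}}
  have hcoord : Measurable fun z : EuclideanSpace ℝ (Fin 2) => z 0 :=
    (EuclideanSpace.proj (𝕜 := ℝ) (0 : Fin 2)).continuous.measurable
  have hZ : MeasurableSet Z := hcoord (measurableSet_displaced m)
  have hpt : ∀ᵐ y ∂(graphMeasure.restrict B), ENNReal.ofReal (Metric.infDist y
      (horizontalLine (base m t) : Set (EuclideanSpace ℝ (Fin 2))) / r) ^ p ≤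
      Z.indicator (fun _ => ENNReal.ofReal (a ^ p)) y + ENNReal.ofReal (a ^ p / branching m) := by
    filter_upwards [ae_restrict_of_ae ae_graphMeasure,
      ae_restrict_mem Metric.isClosed_closedBall.measurableSet] with y hy hyB
    obtain ⟨s, rfl⟩ : ∃ s, y = point s := ⟨y 0, hy.2⟩
    have hb : base m s = base m t := hbase s (by
      simpa using (abs_coord_sub_le_dist (point s) (point t) 1).trans hyB)
    have hd := infDist_point_horizontalLine_le m s
    rw [hb] at hd
    rw [ENNReal.ofReal_rpow_of_nonneg (div_nonneg Metric.infDist_nonneg hr0.le) (by linarith)]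
    by_cases hs : Displaced m s
    · have hmem : point s ∈ Z := by simpa [Z] using hs
      rw [Set.indicator_of_mem hmem]
      refine le_trans (ENNReal.ofReal_le_ofReal ?_) le_self_add
      refine Real.rpow_le_rpow (div_nonneg Metric.infDist_nonneg hr0.le) ?_ (by linarith)
      refine div_le_div_of_nonneg_right ?_ hr0.le
      have := height_le m s
      linarith
    · refine le_trans (ENNReal.ofReal_le_ofReal ?_) le_add_self
      have h1 := height_sub_base_le_of_not_displaced hs
      rw [hb] at h1
      have h2 : Metric.infDist (point s)
          (horizontalLine (base m t) : Set (EuclideanSpace ℝ (Fin 2))) / r ≤ a / branching m := by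
        have h3 : a / branching m = 5 / 4 * scale (m + 1) / r := by
          rw [ha, scale_succ]; field_simp
        rw [h3]
        exact div_le_div_of_nonneg_right (hd.trans h1) hr0.le
      refine (Real.rpow_le_rpow (div_nonneg Metric.infDist_nonneg hr0.le) h2 (by linarith)).trans ?_
      rw [Real.div_rpow ha0.le hq.le]
      -- Only one factor `1 / branching m` is kept of its `p`-th power, to match the displaced part.
      refine div_le_div_of_nonneg_left (by positivity) hq ?_
      exact Real.self_le_rpow_of_one_le (by linarith [five_le_branching m]) hp
  have hsub : B ⊆ {z | z 0 ∈ Set.Icc (t - r) (t + r)} := fun z hz => by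
    have h := abs_le.1 ((abs_coord_sub_le_dist z (point t) 0).trans hz)
    rw [point_zero] at h
    exact ⟨by linarith [h.1], by linarith [h.2]⟩
  have hBZ : graphMeasure (Z ∩ B) ≤ ENNReal.ofReal (18 * r / branching m) := by
    calc graphMeasure (Z ∩ B)
        ≤ graphMeasure {z | z 0 ∈ Set.Icc (t - r) (t + r) ∩ {s | Displaced m s}} :=
          measure_mono fun z hz => ⟨hsub hz.2, hz.1⟩
      _ ≤ 3 * ENNReal.ofReal (6 * r / branching m) :=
          (graphMeasure_over_le _).trans (by gcongr; exact volume_inter_displaced_le hr)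
      _ = ENNReal.ofReal (3 * (6 * r / branching m)) := by
          rw [ENNReal.ofReal_mul (by norm_num)]; norm_num
      _ = _ := by congr 1; ring
  have hB : graphMeasure B ≤ ENNReal.ofReal (6 * r) := by
    refine (graphMeasure_closedBall_le _ _).trans (le_of_eq ?_)
    rw [show 6 * r = 3 * (2 * r) by ring, ENNReal.ofReal_mul (p := 3) (by norm_num)]; norm_num
  calc _ ≤ ∫⁻ y in B, (Z.indicator (fun _ => ENNReal.ofReal (a ^ p)) y +
        ENNReal.ofReal (a ^ p / branching m)) ∂graphMeasure := lintegral_mono_ae hpt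
    _ = ENNReal.ofReal (a ^ p) * graphMeasure (Z ∩ B) +
        ENNReal.ofReal (a ^ p / branching m) * graphMeasure B := by
        rw [lintegral_add_right _ measurable_const, lintegral_indicator_const hZ,
          lintegral_const, Measure.restrict_apply hZ, Measure.restrict_apply_univ]
    _ ≤ ENNReal.ofReal (a ^ p) * ENNReal.ofReal (18 * r / branching m) +
        ENNReal.ofReal (a ^ p / branching m) * ENNReal.ofReal (6 * r) := by gcongr
    _ = _ := by
        rw [← ENNReal.ofReal_mul (by positivity), ← ENNReal.ofReal_mul (by positivity),
          ← ENNReal.ofReal_add (by positivity) (by positivity)]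
        congr 1; ring

lemma betaCoeff_sq_div_le {m : ℕ} {t r p : ℝ} (hp : 1 ≤ p) (hr : scale m / 2 ≤ r)
    (hbase : ∀ s, |height s - height t| ≤ r → base m s = base m t) :
    betaCoeff 1 graphMeasure p (point t) r ^ 2 / ENNReal.ofReal r ≤
      ENNReal.ofReal ((24 / branching m) ^ (2 / p) * (25 / 16 * scale m ^ 2) * r ^ (-3 : ℝ)) := by
  have h0 := scale_pos m
  have hq := branching_pos m
  have hr0 : 0 < r := by linarith
  set a := 5 / 4 * scale m / r with ha
  have ha0 : 0 < a := by positivity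
  have hbeta : betaCoeff 1 graphMeasure p (point t) r ≤
      ENNReal.ofReal ((24 / branching m) ^ (1 / p) * a) := by
    refine (iInf₂_le (horizontalLine (base m t)) (isPlane_horizontalLine _)).trans ?_
    calc _ ≤ (ENNReal.ofReal (24 * r * a ^ p / branching m) / ENNReal.ofReal (r ^ 1)) ^ (1 / p) := by
          gcongr
          exact lintegral_infDist_rpow_le hp hr hbase
      _ = ENNReal.ofReal ((24 / branching m * a ^ p) ^ (1 / p)) := by
          rw [← ENNReal.ofReal_div_of_pos (by positivity),
            ENNReal.ofReal_rpow_of_nonneg (by positivity) (by positivity)]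
          congr 2
          field_simp
      _ = _ := by
          rw [Real.mul_rpow (by positivity) (by positivity), ← Real.rpow_mul ha0.le,
            mul_one_div_cancel (by linarith), Real.rpow_one]
  calc betaCoeff 1 graphMeasure p (point t) r ^ 2 / ENNReal.ofReal r
      ≤ ENNReal.ofReal ((24 / branching m) ^ (1 / p) * a) ^ 2 / ENNReal.ofReal r := by gcongr
    _ = ENNReal.ofReal (((24 / branching m) ^ (1 / p) * a) ^ 2 / r) := by
        rw [← ENNReal.ofReal_pow (by positivity), ENNReal.ofReal_div_of_pos hr0]
    _ = _ := by
        congr 1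
        have h1 : ((24 / branching m : ℝ) ^ (1 / p)) ^ 2 = (24 / branching m) ^ (2 / p) := by
          rw [← Real.rpow_natCast, ← Real.rpow_mul (by positivity)]
          congr 1; push_cast; ring
        have h2 : r ^ (-3 : ℝ) = (r ^ 3)⁻¹ := by
          rw [Real.rpow_neg hr0.le]; norm_cast
        rw [mul_pow, h1, h2, ha]
        field_simp
        ring

lemma lintegral_rpow_neg_three {c a : ℝ} (hc : 0 ≤ c) (ha : 0 < a) :
    ∫⁻ r in Set.Ioi a, ENNReal.ofReal (c * r ^ (-3 : ℝ)) = ENNReal.ofReal (c / (2 * a ^ 2)) := by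
  rw [← ofReal_integral_eq_lintegral_ofReal
    ((integrableOn_Ioi_rpow_of_lt (by norm_num) ha).const_mul c), integral_const_mul,
    integral_Ioi_rpow_of_lt (by norm_num) ha]
  · congr 1
    have : a ^ (-3 + 1 : ℝ) = (a ^ 2)⁻¹ := by
      rw [show (-3 + 1 : ℝ) = -(2 : ℕ) by norm_num, Real.rpow_neg ha.le, Real.rpow_natCast]
    rw [this]
    field_simp
    norm_num
  · filter_upwards [ae_restrict_mem measurableSet_Ioi] with r hr
    have : 0 < r := ha.trans hr
    positivity

/-- The radii at which the graph is approximated by its horizontal lines of generation `m`. -/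
def radii : ℕ → Set ℝ
  | 0 => Set.Ioi (scale 0 / 2)
  | m + 1 => Set.Ioc (scale (m + 1) / 2) (scale m / 2)

lemma radii_subset (m : ℕ) : radii m ⊆ Set.Ioi (scale m / 2) := by
  cases m
  · exact subset_rfl
  · exact Set.Ioc_subset_Ioi_self

lemma measurableSet_radii (m : ℕ) : MeasurableSet (radii m) := by
  cases m
  exacts [measurableSet_Ioi, measurableSet_Ioc]

lemma base_eq_of_mem_radii {m : ℕ} {r s t : ℝ} (hr : r ∈ radii m)
    (h : |height s - height t| ≤ r) : base m s = base m t := by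
  cases m
  -- `base 0` vanishes identically, so generation 0 can serve all large radii.
  · rw [base_zero, base_zero]
  · exact base_eq_of_abs_height_sub_le (h.trans hr.2)

lemma Ioc_subset_iUnion_radii : Set.Ioc (0 : ℝ) 1 ⊆ ⋃ m, radii m := by
  classical
  rintro r ⟨hr0, hr1⟩
  have hex : ∃ m, scale m / 2 < r := by
    have h := (tendsto_scale.div_const 2).eventually (gt_mem_nhds (show 0 / 2 < r by simpa))
    exact h.exists
  refine Set.mem_iUnion.2 ⟨Nat.find hex, ?_⟩
  have hspec := Nat.find_spec hex
  have hmin := fun m hm => Nat.find_min hex (m := m) hm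
  generalize Nat.find hex = n at hspec hmin
  cases n with
  | zero => exact hspec
  | succ m => exact ⟨hspec, not_lt.1 (hmin m (Nat.lt_succ_self m))⟩

/-- This is where `p < 2` enters: it makes the exponent `2 / p` exceed 1. -/
lemma summable_branching_rpow {p : ℝ} (hp : 1 ≤ p) (hp2 : p < 2) :
    Summable fun m : ℕ => (24 / branching m : ℝ) ^ (2 / p) := by
  have h : Summable fun n : ℕ => 1 / (n : ℝ) ^ (2 / p) :=
    Real.summable_one_div_nat_rpow.2 ((one_lt_div (by linarith)).2 hp2)
  refine (((summable_nat_add_iff 5).2 h).mul_left ((24 : ℝ) ^ (2 / p))).congr fun m => ?_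
  rw [Real.div_rpow (by norm_num) (branching_pos m).le, branching]
  ring

lemma betaSquareFunction_lt_top {p : ℝ} (hp : 1 ≤ p) (hp2 : p < 2) (t : ℝ) :
    betaSquareFunction 1 graphMeasure p (point t) < ∞ := by
  have hterm : ∀ m, ∫⁻ r in radii m, betaCoeff 1 graphMeasure p (point t) r ^ 2 /
      ENNReal.ofReal r ≤ ENNReal.ofReal (25 / 8 * (24 / branching m : ℝ) ^ (2 / p)) := fun m => by
    have h0 := scale_pos m
    have hq := branching_pos m
    calc _ ≤ ∫⁻ r in radii m, ENNReal.ofReal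
          ((24 / branching m) ^ (2 / p) * (25 / 16 * scale m ^ 2) * r ^ (-3 : ℝ)) := by
          refine setLIntegral_mono' (measurableSet_radii m) fun r hr => ?_
          exact betaCoeff_sq_div_le hp (le_of_lt (radii_subset m hr))
            fun s hs => base_eq_of_mem_radii hr hs
      _ ≤ ∫⁻ r in Set.Ioi (scale m / 2), ENNReal.ofReal
          ((24 / branching m) ^ (2 / p) * (25 / 16 * scale m ^ 2) * r ^ (-3 : ℝ)) :=
          lintegral_mono_set (radii_subset m)
      _ = _ := by
          rw [lintegral_rpow_neg_three (by positivity) (by positivity)]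
          congr 1
          field_simp
          norm_num
  have hsum := (summable_branching_rpow hp hp2).mul_left (25 / 8)
  calc betaSquareFunction 1 graphMeasure p (point t)
      ≤ ∫⁻ r in ⋃ m, radii m, betaCoeff 1 graphMeasure p (point t) r ^ 2 / ENNReal.ofReal r :=
        lintegral_mono_set Ioc_subset_iUnion_radii
    _ ≤ ∑' m, ∫⁻ r in radii m, betaCoeff 1 graphMeasure p (point t) r ^ 2 / ENNReal.ofReal r :=
        lintegral_iUnion_le _ _
    _ ≤ ∑' m, ENNReal.ofReal (25 / 8 * (24 / branching m : ℝ) ^ (2 / p)) :=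
        ENNReal.tsum_le_tsum hterm
    _ < ∞ := hsum.tsum_ofReal_lt_top

end DisplacedGraph

open DisplacedGraph in
theorem theorem1p1 :
    ∃ E : Set (EuclideanSpace ℝ (Fin 2)),
      IsCompact E ∧
      0 < (μH[1] : Measure (EuclideanSpace ℝ (Fin 2))) E ∧
      (μH[1] : Measure (EuclideanSpace ℝ (Fin 2))) E < ∞ ∧
      PurelyUnrectifiable 1 E ∧
      (∀ p : ℝ, 1 ≤ p → p < 2 →
        ∀ᵐ x ∂((μH[1] : Measure (EuclideanSpace ℝ (Fin 2))).restrict E),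
          betaSquareFunction 1 ((μH[1] : Measure (EuclideanSpace ℝ (Fin 2))).restrict E) p x
            < ∞) ∧
      (∀ᵐ x ∂((μH[1] : Measure (EuclideanSpace ℝ (Fin 2))).restrict E),
        0 < upperDensity 1 ((μH[1] : Measure (EuclideanSpace ℝ (Fin 2))).restrict E) x ∧
        upperDensity 1 ((μH[1] : Measure (EuclideanSpace ℝ (Fin 2))).restrict E) x < ∞) ∧
      ¬ MeasureRectifiable 1 ((μH[1] : Measure (EuclideanSpace ℝ (Fin 2))).restrict E) := by
  refine ⟨graphClosure, isCompact_graphClosure, hausdorffMeasure_graphClosure_pos,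
    hausdorffMeasure_graphClosure_lt_top, purelyUnrectifiable_graphClosure, fun p hp hp2 => ?_,
    ?_, fun h => ?_⟩
  · filter_upwards [ae_graphMeasure] with x hx
    rw [hx.2]
    exact betaSquareFunction_lt_top hp hp2 _
  · filter_upwards [ae_graphMeasure] with x hx
    refine ⟨?_, upperDensity_graphMeasure_lt_top x⟩
    rw [hx.2]
    exact upperDensity_graphMeasure_pos hx.1
  · refine hausdorffMeasure_graphClosure_pos.ne' ?_
    have := purelyUnrectifiable_graphClosure graphClosure subset_rfl
      (by rw [SetRectifiable, Nat.cast_one]; exact h)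
    rwa [Nat.cast_one] at this
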